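/- Let $M$ be a connected, Hausdorff, second countable, finite-dimensional $C^\infty$ manifold without boundary, and let $p\colon V\to M$ be a $C^\infty$ real vector bundle of finite rank. An automorphism of $V$ is a $C^\infty$ diffeomorphism $\Phi\colon V\to V$ of the total space such that for every $x\in M$ there is a point $x'\in M$ for which $\Phi$ restricts to an $\mathbb{R}$-linear isomorphism from the fibre $V_x=p^{-1}(x)$ onto the fibre $V_{x'}$. Let $\mathrm{AUT}\,V$ be the set of all automorphisms of $V$, and let $h_V\colon \mathrm{AUT}\,V\to\mathrm{Diff}\,M$ be the map sending $\Phi$ to the $C^\infty$ diffeomorphism $\varphi$ of $M$ that it induces, $\varphi(x)=x'$, so that $p\circ\Phi=\varphi\circ p$. If a $C^\infty$ diffeomorphism $\varphi\colon M\to M$ is $C^0$-homotopic to the identity map of $M$ (that is, there is a continuous map $H\colon [0,1]\times M\to M$ with $H(0,\cdot)=\varphi$ and $H(1,\cdot)=\mathrm{id}_M$), then there exists $\Phi\in\mathrm{AUT}\,V$ such that $h_V(\Phi)=\varphi$. -/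

import Mathlib

open Bundle
open scoped Manifold ContDiff

noncomputable section

/-- An automorphism of the smooth real vector bundle `V → M` (with model fibre `F`): a `C^∞`
diffeomorphism `Φ` of the total space which maps every fibre `V x` onto a fibre `V x'` by an
`ℝ`-linear isomorphism. -/
structure SmoothBundleAut {E : Type*} [NormedAddCommGroup E] [NormedSpace ℝ E]
    {M : Type*} [TopologicalSpace M] [ChartedSpace E M]
    (F : Type*) [NormedAddCommGroup F] [NormedSpace ℝ F]
    (V : M → Type*) [TopologicalSpace (TotalSpace F V)]
    [∀ x, AddCommGroup (V x)] [∀ x, Module ℝ (V x)] [∀ x, TopologicalSpace (V x)]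
    [FiberBundle F V] where
  /-- the underlying diffeomorphism of the total space -/
  toDiffeomorph :
    Diffeomorph (𝓘(ℝ, E).prod 𝓘(ℝ, F)) (𝓘(ℝ, E).prod 𝓘(ℝ, F))
      (TotalSpace F V) (TotalSpace F V) ∞
  map_fiber' : ∀ x : M, ∃ (x' : M) (L : V x ≃ₗ[ℝ] V x'), ∀ v : V x,
    toDiffeomorph (TotalSpace.mk' F x v) = TotalSpace.mk' F x' (L v)

namespace SmoothBundleAut

section

variable {E : Type*} [NormedAddCommGroup E] [NormedSpace ℝ E]
  {M : Type*} [TopologicalSpace M] [ChartedSpace E M]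
  {F : Type*} [NormedAddCommGroup F] [NormedSpace ℝ F]
  {V : M → Type*} [TopologicalSpace (TotalSpace F V)]
  [∀ x, AddCommGroup (V x)] [∀ x, Module ℝ (V x)] [∀ x, TopologicalSpace (V x)]
  [FiberBundle F V]

/-- The map induced on the base: `x ↦ x'` where `Φ` maps `V x` onto `V x'`. It is computed
on the zero vector of `V x`; see `proj_apply` for the independence of this choice. -/
def baseFun (Φ : SmoothBundleAut (E := E) F V) (x : M) : M :=
  (Φ.toDiffeomorph (TotalSpace.mk' F x (0 : V x))).proj

theorem proj_apply (Φ : SmoothBundleAut (E := E) F V) (p : TotalSpace F V) :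
    (Φ.toDiffeomorph p).proj = Φ.baseFun p.proj := by
  obtain ⟨x, v⟩ := p
  obtain ⟨x', L, hL⟩ := Φ.map_fiber' x
  have h1 := congrArg TotalSpace.proj (hL v)
  have h2 := congrArg TotalSpace.proj (hL 0)
  exact h1.trans h2.symm

/-- The inverse of an automorphism is an automorphism. -/
def symm (Φ : SmoothBundleAut (E := E) F V) : SmoothBundleAut (E := E) F V where
  toDiffeomorph := Φ.toDiffeomorph.symm
  map_fiber' y := by
    obtain ⟨p, hp⟩ := Φ.toDiffeomorph.surjective (TotalSpace.mk' F y (0 : V y))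
    obtain ⟨x', L, hL⟩ := Φ.map_fiber' p.proj
    have hy : x' = y := by
      have h := (hL p.snd).symm.trans hp
      exact congrArg TotalSpace.proj h
    subst hy
    refine ⟨p.proj, L.symm, fun w => ?_⟩
    apply Φ.toDiffeomorph.injective
    have h := hL (L.symm w)
    rw [LinearEquiv.apply_symm_apply] at h
    exact (Φ.toDiffeomorph.apply_symm_apply _).trans h.symm

theorem baseFun_symm_baseFun (Φ : SmoothBundleAut (E := E) F V) (x : M) :
    Φ.symm.baseFun (Φ.baseFun x) = x := by
  have h := Φ.symm.proj_apply (Φ.toDiffeomorph (TotalSpace.mk' F x (0 : V x)))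
  have h' : Φ.symm.toDiffeomorph (Φ.toDiffeomorph (TotalSpace.mk' F x (0 : V x)))
      = TotalSpace.mk' F x (0 : V x) := Φ.toDiffeomorph.symm_apply_apply _
  rw [h'] at h
  exact h.symm

theorem contMDiff_baseFun [VectorBundle ℝ F V] [ContMDiffVectorBundle ∞ F V 𝓘(ℝ, E)]
    (Φ : SmoothBundleAut (E := E) F V) : ContMDiff 𝓘(ℝ, E) 𝓘(ℝ, E) ∞ Φ.baseFun :=
  (Bundle.contMDiff_proj (IB := 𝓘(ℝ, E)) (n := ∞) V).comp
    (Φ.toDiffeomorph.contMDiff.comp (Bundle.contMDiff_zeroSection ℝ V))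

/-- `h_V : AUT V → Diff M`, sending an automorphism of `V` to the diffeomorphism which it induces
on the base manifold. -/
def hV [VectorBundle ℝ F V] [ContMDiffVectorBundle ∞ F V 𝓘(ℝ, E)]
    (Φ : SmoothBundleAut (E := E) F V) : Diffeomorph 𝓘(ℝ, E) 𝓘(ℝ, E) M M ∞ where
  toFun := Φ.baseFun
  invFun := Φ.symm.baseFun
  left_inv := Φ.baseFun_symm_baseFun
  right_inv := Φ.symm.baseFun_symm_baseFun
  contMDiff_toFun := Φ.contMDiff_baseFun
  contMDiff_invFun := Φ.symm.contMDiff_baseFun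

end

end SmoothBundleAut

end

section

open Set Filter Topology ContinuousLinearMap

/-! Fibres are carried along the paths `t ↦ H (t, x)` from `x` to `φ x`. As these paths are only
continuous, the role of a connection is played by a two-point transport `T x y : V x → V y`, the
identity for `x = y` and hence invertible for `y` near `x`
(`exists_continuous_two_point_transport`). Cutting each path into steps so short that `T` is
invertible on each, and composing, gives isomorphisms `L x : V x → V (φ x)`. Steps after time `1`
are identities, so the number of steps does not matter and `L` is continuous
(`exists_continuous_lift_of_homotopy`).

For a fibrewise norm `p`, the condition `p (A v - L v) < p (L v)` for all `v ≠ 0` is convex in `A`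
and forces injectivity, so smooth local solutions glue to a smooth isomorphism
(`exists_contMDiff_of_continuous_lift`). Its inverse is smooth because inversion of operators is.
Both `T` and the smoothing come from one gluing lemma, `exists_contMDiff_hom_forall_mem_convex`. -/

theorem VectorBundle.isTopologicalAddGroup_fiber {M : Type*} [TopologicalSpace M] (F : Type*)
    [NormedAddCommGroup F] [NormedSpace ℝ F] (V : M → Type*) [TopologicalSpace (TotalSpace F V)]
    [∀ x, AddCommGroup (V x)] [∀ x, Module ℝ (V x)] [∀ x, TopologicalSpace (V x)]
    [FiberBundle F V] [VectorBundle ℝ F V] (x : M) :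
    IsTopologicalAddGroup (V x) := by
  let e := VectorBundle.continuousLinearEquivAt ℝ F V x
  refine { continuous_add := ?_, continuous_neg := ?_ }
  · have h : (fun p : V x × V x => p.1 + p.2) = fun p => e.symm (e p.1 + e p.2) := by
      ext p; simp
    rw [h]; fun_prop
  · have h : (fun p : V x => -p) = fun p => e.symm (-e p) := by
      ext p; simp
    rw [h]; fun_prop

theorem VectorBundle.continuousSMul_fiber {M : Type*} [TopologicalSpace M] (F : Type*)
    [NormedAddCommGroup F] [NormedSpace ℝ F] (V : M → Type*) [TopologicalSpace (TotalSpace F V)]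
    [∀ x, AddCommGroup (V x)] [∀ x, Module ℝ (V x)] [∀ x, TopologicalSpace (V x)]
    [FiberBundle F V] [VectorBundle ℝ F V] (x : M) :
    ContinuousSMul ℝ (V x) := by
  let e := VectorBundle.continuousLinearEquivAt ℝ F V x
  refine ⟨?_⟩
  have h : (fun p : ℝ × V x => p.1 • p.2) = fun p => e.symm (p.1 • e p.2) := by
    ext p; simp
  rw [h]; fun_prop

/-! ### Gluing smooth bundle maps under convex conditions -/

section Glue

variable {E : Type*} [NormedAddCommGroup E] [NormedSpace ℝ E]
  {M : Type*} [TopologicalSpace M] [ChartedSpace E M]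
  {F : Type*} [NormedAddCommGroup F] [NormedSpace ℝ F]
  {V : M → Type*} [TopologicalSpace (TotalSpace F V)]
  [∀ x, AddCommGroup (V x)] [∀ x, Module ℝ (V x)] [∀ x, TopologicalSpace (V x)]
  [FiberBundle F V] [VectorBundle ℝ F V]

variable (F V) in
/-- The linear map `V x → V y` whose expression in the preferred trivializations at `x₀` and `y₀`
is the given endomorphism `A` of the model fibre. -/
noncomputable def Bundle.homOfModel (x₀ y₀ : M) (A : F →L[ℝ] F) (x y : M) : V x →L[ℝ] V y :=
  ((trivializationAt F V y₀).symmL ℝ y).comp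
    (A.comp ((trivializationAt F V x₀).continuousLinearMapAt ℝ x))

variable {EN HN N : Type*} [NormedAddCommGroup EN] [NormedSpace ℝ EN] [TopologicalSpace HN]
  {I : ModelWithCorners ℝ EN HN} [TopologicalSpace N] [ChartedSpace HN N]

/-- Near `n` the coordinate expression is `A` between two coordinate changes, which are smooth. -/
theorem Bundle.contMDiffAt_inCoordinates_homOfModel [ContMDiffVectorBundle ∞ F V 𝓘(ℝ, E)]
    {a b : N → M} {n : N} (ha : ContMDiffAt I 𝓘(ℝ, E) ∞ a n) (hb : ContMDiffAt I 𝓘(ℝ, E) ∞ b n)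
    {x₀ y₀ : M} (hx : a n ∈ (trivializationAt F V x₀).baseSet)
    (hy : b n ∈ (trivializationAt F V y₀).baseSet) (A : F →L[ℝ] F) :
    ContMDiffAt I 𝓘(ℝ, F →L[ℝ] F) ∞ (fun m => inCoordinates F V F V (a n) (a m) (b n) (b m)
      (homOfModel F V x₀ y₀ A (a m) (b m))) n := by
  have hx' := FiberBundle.mem_baseSet_trivializationAt' (F := F) (E := V) (a n)
  have hy' := FiberBundle.mem_baseSet_trivializationAt' (F := F) (E := V) (b n)
  have h1 := ha.coordChangeL (F := F) (E := V) hx' hx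
  have h2 := hb.coordChangeL (F := F) (E := V) hy hy'
  refine ((h2.clm_comp (contMDiffAt_const (c := A))).clm_comp h1).congr_of_eventuallyEq ?_
  filter_upwards [ha.continuousAt ((trivializationAt F V x₀).open_baseSet.mem_nhds hx),
    hb.continuousAt ((trivializationAt F V y₀).open_baseSet.mem_nhds hy),
    ha.continuousAt ((trivializationAt F V (a n)).open_baseSet.mem_nhds hx'),
    hb.continuousAt ((trivializationAt F V (b n)).open_baseSet.mem_nhds hy')] with m m1 m2 m3 m4
  simp only [mem_preimage] at m1 m2 m3 m4
  ext u
  simp [inCoordinates, homOfModel, Trivialization.coordChangeL_apply, m1, m2, m3, m4,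
    Trivialization.linearMapAt_apply, Trivialization.symmL_apply]

/-- Locally constant (in the preferred trivializations) choices of linear maps `V (a n) → V (b n)`
subject to a convex condition can be glued to a smooth choice. -/
theorem Bundle.exists_contMDiff_hom_forall_mem_convex [ContMDiffVectorBundle ∞ F V 𝓘(ℝ, E)]
    [∀ x, IsTopologicalAddGroup (V x)] [∀ x, ContinuousSMul ℝ (V x)]
    [FiniteDimensional ℝ EN] [IsManifold I ∞ N] [T2Space N] [SigmaCompactSpace N]
    {a b : N → M} (ha : ContMDiff I 𝓘(ℝ, E) ∞ a) (hb : ContMDiff I 𝓘(ℝ, E) ∞ b)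
    (C : ∀ n, Set (V (a n) →L[ℝ] V (b n))) (hC : ∀ n, Convex ℝ (C n))
    (H : ∀ n₀, ∃ A : F →L[ℝ] F, ∀ᶠ n in 𝓝 n₀, homOfModel F V (a n₀) (b n₀) A (a n) (b n) ∈ C n) :
    ∃ B : ∀ n, V (a n) →L[ℝ] V (b n), (∀ n, B n ∈ C n) ∧
      ∀ n₀, ContMDiffAt I 𝓘(ℝ, F →L[ℝ] F) ∞
        (fun n => inCoordinates F V F V (a n₀) (a n) (b n₀) (b n) (B n)) n₀ := by
  choose A hA using H
  let W : N → Set N := fun n₀ =>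
    (a ⁻¹' (trivializationAt F V (a n₀)).baseSet ∩ b ⁻¹' (trivializationAt F V (b n₀)).baseSet) ∩
      interior {n | homOfModel F V (a n₀) (b n₀) (A n₀) (a n) (b n) ∈ C n}
  have hWo : ∀ n₀, IsOpen (W n₀) := fun n₀ =>
    (((trivializationAt F V (a n₀)).open_baseSet.preimage ha.continuous).inter
      ((trivializationAt F V (b n₀)).open_baseSet.preimage hb.continuous)).inter isOpen_interior
  have hW : ∀ n₀, n₀ ∈ W n₀ := fun n₀ =>
    ⟨⟨FiberBundle.mem_baseSet_trivializationAt' _, FiberBundle.mem_baseSet_trivializationAt' _⟩,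
      mem_interior_iff_mem_nhds.2 (hA n₀)⟩
  obtain ⟨ρ, hρ⟩ := SmoothPartitionOfUnity.exists_isSubordinate I isClosed_univ W hWo
    fun x _ => mem_iUnion.2 ⟨x, hW x⟩
  refine ⟨fun n => ∑ᶠ i, ρ i n • homOfModel F V (a i) (b i) (A i) (a n) (b n), fun n => ?_,
    fun n₀ => ?_⟩
  · refine ρ.toPartitionOfUnity.finsum_smul_mem_convex
      (g := fun i _ => homOfModel F V (a i) (b i) (A i) (a n) (b n)) (mem_univ n)
      (fun i hi => ?_) (hC n)
    exact (interior_subset (hρ i (subset_tsupport _ hi)).2 :)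
  · refine (ρ.contMDiffAt_finsum (g := fun i n => inCoordinates F V F V (a n₀) (a n) (b n₀) (b n)
      (homOfModel F V (a i) (b i) (A i) (a n) (b n))) fun i hi =>
        contMDiffAt_inCoordinates_homOfModel (ha n₀) (hb n₀) (hρ i hi).1.1 (hρ i hi).1.2
          (A i)).congr_of_eventuallyEq ?_
    refine Eventually.of_forall fun n => ?_
    -- Both sums are finite over the same indices, and `inCoordinates` is linear in the map.
    have hfin : (Function.support fun i => ρ i n).Finite := ρ.locallyFinite.point_finite n
    have h1 := finsum_eq_sum_of_support_subset
      (fun i => ρ i n • homOfModel F V (a i) (b i) (A i) (a n) (b n)) (s := hfin.toFinset)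
      (fun i hi => by
        simp only [Finite.coe_toFinset, Function.mem_support] at hi ⊢
        exact fun h => hi (by rw [h, zero_smul]))
    have h2 := finsum_eq_sum_of_support_subset
      (fun i => ρ i n • inCoordinates F V F V (a n₀) (a n) (b n₀) (b n)
        (homOfModel F V (a i) (b i) (A i) (a n) (b n))) (s := hfin.toFinset)
      (fun i hi => by
        simp only [Finite.coe_toFinset, Function.mem_support] at hi ⊢
        exact fun h => hi (by rw [h, zero_smul]))
    refine (congrArg _ h1).trans (Eq.trans ?_ h2.symm)
    ext u
    simp [inCoordinates, map_sum]

end Glue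

/-! ### Two-point transport -/

section Transport

variable {E : Type*} [NormedAddCommGroup E] [NormedSpace ℝ E]
  {M : Type*} [TopologicalSpace M] [ChartedSpace E M]
  {F : Type*} [NormedAddCommGroup F] [NormedSpace ℝ F]
  {V : M → Type*} [TopologicalSpace (TotalSpace F V)]
  [∀ x, AddCommGroup (V x)] [∀ x, Module ℝ (V x)] [∀ x, TopologicalSpace (V x)]
  [FiberBundle F V] [VectorBundle ℝ F V]

theorem Bundle.bijective_iff_bijective_inCoordinates {x₀ x y₀ y : M}
    (hx : x ∈ (trivializationAt F V x₀).baseSet) (hy : y ∈ (trivializationAt F V y₀).baseSet)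
    (A : V x →L[ℝ] V y) :
    Function.Bijective (inCoordinates F V F V x₀ x y₀ y A) ↔ Function.Bijective A := by
  rw [inCoordinates_eq hx hy]
  rw [ContinuousLinearMap.coe_comp, ContinuousLinearMap.coe_comp]
  exact (Function.Bijective.of_comp_iff' (ContinuousLinearEquiv.bijective _) _).trans
    (Function.Bijective.of_comp_iff _ (ContinuousLinearEquiv.bijective _))

/-- A continuous two-point transport: a smooth family of linear maps `V x → V y` which is the
identity on the diagonal, and invertible near the diagonal. -/
theorem Bundle.exists_continuous_two_point_transport [CompleteSpace F]
    [ContMDiffVectorBundle ∞ F V 𝓘(ℝ, E)]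
    [FiniteDimensional ℝ E] [IsManifold 𝓘(ℝ, E) ∞ M] [T2Space M] [SigmaCompactSpace M] :
    ∃ T : ∀ x y : M, V x →L[ℝ] V y, (∀ x v, T x x v = v) ∧
      (∀ x, ∀ᶠ q : M × M in 𝓝 (x, x), Function.Bijective (T q.1 q.2)) ∧
      Continuous fun q : TotalSpace F V × M => TotalSpace.mk' F q.2 (T q.1.proj q.2 q.1.snd) := by
  have := VectorBundle.isTopologicalAddGroup_fiber F V
  have := VectorBundle.continuousSMul_fiber F V
  obtain ⟨B, hB, hBs⟩ := exists_contMDiff_hom_forall_mem_convex (F := F) (V := V) (N := M × M)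
    (I := 𝓘(ℝ, E).prod 𝓘(ℝ, E)) contMDiff_fst contMDiff_snd
    -- The two fibres are different types, so being the identity on the diagonal is stated in the
    -- total space.
    (fun q => {A | q.1 = q.2 → ∀ v, TotalSpace.mk' F q.2 (A v) = TotalSpace.mk' F q.1 v})
    (by
      rintro ⟨x, y⟩
      by_cases h : x = y
      · subst h
        intro A hA B hB s t hs ht hst
        simp only [mem_ofPred_eq, forall_const, TotalSpace.mk_inj] at hA hB ⊢
        intro v
        simp [hA v, hB v, ← add_smul, hst]
      · simp [h, convex_univ])
    (by
      rintro ⟨x, y⟩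
      by_cases h : x = y
      · subst h
        refine ⟨ContinuousLinearMap.id ℝ F, ?_⟩
        have h1 := (trivializationAt F V x).open_baseSet.mem_nhds
          (FiberBundle.mem_baseSet_trivializationAt' x)
        filter_upwards [continuousAt_fst (p := (x, x)) h1] with q hq h v
        obtain ⟨y, z⟩ := q
        obtain rfl : y = z := h
        exact congrArg _ (Trivialization.symmL_continuousLinearMapAt _ hq v)
      -- Off the diagonal, which is closed, the condition is vacuous nearby and any map serves.
      · refine ⟨0, ?_⟩
        filter_upwards [(isClosed_diagonal.isOpen_compl.mem_nhds h : _ ∈ 𝓝 (x, y))] with q hq h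
        exact absurd h hq)
  have hid : ∀ x v, B (x, x) v = v := fun x v => by simpa using hB (x, x) rfl v
  refine ⟨fun x y => B (x, y), hid, fun x => ?_, ?_⟩
  · have h0 : inCoordinates F V F V x x x x (B (x, x)) = ContinuousLinearMap.id ℝ F := by
      rw [inCoordinates_eq (FiberBundle.mem_baseSet_trivializationAt' x)
        (FiberBundle.mem_baseSet_trivializationAt' x)]
      ext u
      simp only [coe_comp, Function.comp_apply, hid, ContinuousLinearEquiv.coe_coe]
      exact ContinuousLinearEquiv.apply_symm_apply _ u
    have hc := (hBs (x, x)).continuousAt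
    -- Invertibility spreads from the diagonal because units are open in the complete algebra `F
    -- →L[ℝ] F`.
    have hU : {A : F →L[ℝ] F | IsUnit A} ∈ 𝓝 (inCoordinates F V F V x x x x (B (x, x))) := by
      rw [h0]
      exact Units.isOpen.mem_nhds isUnit_one
    have h1 := (trivializationAt F V x).open_baseSet.mem_nhds
      (FiberBundle.mem_baseSet_trivializationAt' x)
    filter_upwards [hc hU, continuousAt_fst (p := (x, x)) h1, continuousAt_snd (p := (x, x)) h1]
      with q hq m1 m2
    refine (bijective_iff_bijective_inCoordinates m1 m2 (B q)).1 ?_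
    exact ContinuousLinearMap.isUnit_iff_bijective.1 hq
  · rw [continuous_iff_continuousAt]
    intro q₀
    refine ContinuousAt.clm_apply_of_inCoordinates (F₁ := F) (E₁ := V) (F₂ := F) (E₂ := V)
      (b₁ := fun q : TotalSpace F V × M => q.1.proj) (b₂ := fun q => q.2)
      (ϕ := fun q => B (q.1.proj, q.2)) (v := fun q => q.1.snd) ?_ continuousAt_fst continuousAt_snd
    have h := (hBs (q₀.1.proj, q₀.2)).continuousAt
    refine ContinuousAt.comp (f := fun q : TotalSpace F V × M => (q.1.proj, q.2)) h ?_
    exact (((FiberBundle.continuous_proj F V).comp continuous_fst).prodMk continuous_snd).continuousAt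

end Transport

/-! ### Continuous lift along the homotopy -/

section Homotopy

/-- A neighbourhood of the diagonal absorbs short pieces of a homotopy, with a length which can be
chosen continuously. -/
theorem ContinuousMap.exists_pos_forall_dist_le_mem {X Y : Type*} [TopologicalSpace X]
    [NormalSpace X] [ParacompactSpace X] [TopologicalSpace Y] (H : C(unitInterval × X, Y))
    {W : Set (Y × Y)} (hW : ∀ y, W ∈ 𝓝 (y, y)) :
    ∃ ε : C(X, ℝ), ∀ x, 0 < ε x ∧
      ∀ s t : unitInterval, dist s t ≤ ε x → (H (s, x), H (t, x)) ∈ W := by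
  -- The admissible lengths at `x` form an interval, so locally constant choices can be averaged.
  refine exists_continuous_forall_mem_convex_of_local_const
    (t := fun x => {r : ℝ | 0 < r ∧
      ∀ s t : unitInterval, dist s t ≤ r → (H (s, x), H (t, x)) ∈ W}) (fun x => ?_) fun x₀ => ?_
  · refine Set.OrdConnected.convex ⟨?_⟩
    intro a ha b hb c hc
    exact ⟨ha.1.trans_le hc.1, fun s t hst => hb.2 s t (hst.trans hc.2)⟩
  · let G : (unitInterval × unitInterval) × X → Y × Y := fun p => (H (p.1.1, p.2), H (p.1.2, p.2))
    have hG : Continuous G := by fun_prop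
    obtain ⟨u, v, hu, hv, hdu, hxv, huv⟩ := generalized_tube_lemma
      (s := diagonal unitInterval) (t := {x₀}) (n := interior (G ⁻¹' W))
      isCompact_diagonal isCompact_singleton isOpen_interior (by
        rintro ⟨⟨s, t⟩, x⟩ ⟨hst, hx⟩
        obtain rfl : s = t := hst
        rw [mem_interior_iff_mem_nhds]
        exact hG.continuousAt (hW (H (s, x))))
    have hu' : u ∈ uniformity unitInterval := by
      rw [← nhdsSet_diagonal_eq_uniformity]
      exact hu.mem_nhdsSet.2 hdu
    obtain ⟨δ, hδ, hδu⟩ := Metric.mem_uniformity_dist.1 hu'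
    -- Halving turns the strict bound `< δ` into the required `≤`.
    refine ⟨δ / 2, ?_⟩
    filter_upwards [hv.mem_nhds (hxv rfl)] with x hx
    refine ⟨half_pos hδ, fun s t hst => ?_⟩
    have h : ((s, t), x) ∈ u ×ˢ v := ⟨hδu (hst.trans_lt (half_lt_self hδ)), hx⟩
    exact (interior_subset (huv h) :)

variable {M : Type*} [TopologicalSpace M]
  {F : Type*} [NormedAddCommGroup F] [NormedSpace ℝ F]
  {V : M → Type*} [TopologicalSpace (TotalSpace F V)]
  [∀ x, AddCommGroup (V x)] [∀ x, Module ℝ (V x)] [∀ x, TopologicalSpace (V x)]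

/-- The vector `v ∈ V x` is moved by the two-point transport `T` along the path `t ↦ H (t, x)`
in `k` steps of length `ε x` (stopping at time `1`). -/
noncomputable def Bundle.transportSteps (T : ∀ x y : M, V x →L[ℝ] V y)
    (H : C(unitInterval × M, M)) (ε : C(M, ℝ)) : ℕ → TotalSpace F V → TotalSpace F V
  | 0, v => v
  | k + 1, v =>
    let w := transportSteps T H ε k v
    let y := H (Set.projIcc 0 1 zero_le_one ((k + 1 : ℕ) * ε v.proj), v.proj)
    ⟨y, T w.proj y w.snd⟩

/-- Homotopy invariance of vector bundles, continuous version. -/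
theorem Bundle.exists_continuous_lift_of_homotopy [FiberBundle F V] [VectorBundle ℝ F V]
    [NormalSpace M] [ParacompactSpace M]
    (T : ∀ x y : M, V x →L[ℝ] V y) (hT : ∀ x v, T x x v = v)
    (hT' : ∀ x, ∀ᶠ q : M × M in 𝓝 (x, x), Function.Bijective (T q.1 q.2))
    (hTc : Continuous fun q : TotalSpace F V × M =>
      TotalSpace.mk' F q.2 (T q.1.proj q.2 q.1.snd))
    (φ : M → M) (H : C(unitInterval × M, M)) (H0 : ∀ x, H (0, x) = x) (H1 : ∀ x, H (1, x) = φ x) :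
    ∃ L : ∀ x, V x →ₗ[ℝ] V (φ x), (∀ x, Function.Bijective (L x)) ∧
      Continuous fun v : TotalSpace F V => TotalSpace.mk' F (φ v.proj) (L v.proj v.snd) := by
  obtain ⟨ε, hε⟩ := H.exists_pos_forall_dist_le_mem (W := {q | Function.Bijective (T q.1 q.2)}) hT'
  let P := transportSteps (F := F) T H ε
  let τ : ℕ → M → unitInterval := fun k x => Set.projIcc 0 1 zero_le_one (k * ε x)
  have hP0 : ∀ v, P 0 v = v := fun v => rfl
  have hPs : ∀ k v, P (k + 1) v = TotalSpace.mk' F (H (τ (k + 1) v.proj, v.proj))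
      (T (P k v).proj (H (τ (k + 1) v.proj, v.proj)) (P k v).snd) := fun k v => rfl
  have hτ0 : ∀ x, τ 0 x = 0 := fun x => by simp [τ, projIcc_of_le_left]
  have hτ1 : ∀ (k : ℕ) x, 1 ≤ k * ε x → τ k x = 1 := fun k x h => by
    simp only [τ]; exact projIcc_of_right_le _ h
  have hτs : ∀ k x, dist (τ k x) (τ (k + 1) x) ≤ ε x := by
    intro k x
    refine (Set.abs_projIcc_sub_projIcc (a := (0:ℝ)) (b := 1) zero_le_one).trans ?_
    push_cast
    rw [show (k * ε x - (k + 1) * ε x : ℝ) = - ε x by ring, abs_neg, abs_of_pos (hε x).1]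
  have hτc : ∀ k, Continuous (τ k) := fun k => continuous_projIcc.comp (by fun_prop)
  have hPc : ∀ k, Continuous (P k) := by
    intro k
    induction k with
    | zero => exact continuous_id
    | succ k ih =>
      have h : Continuous fun v : TotalSpace F V => H (τ (k + 1) v.proj, v.proj) :=
        H.continuous.comp (((hτc _).comp (FiberBundle.continuous_proj F V)).prodMk
          (FiberBundle.continuous_proj F V))
      exact hTc.comp (ih.prodMk h)
  have hPproj : ∀ k v, (P k v).proj = H (τ k v.proj, v.proj) := by
    intro k v
    cases k with
    | zero => rw [hP0, hτ0, H0]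
    | succ k => rfl
  have hPlin : ∀ k x, ∃ L : V x →ₗ[ℝ] V (H (τ k x, x)), Function.Bijective L ∧
      ∀ v, P k ⟨x, v⟩ = ⟨H (τ k x, x), L v⟩ := by
    intro k x
    induction k with
    | zero =>
      rw [hτ0, H0]
      exact ⟨LinearMap.id, Function.bijective_id, fun v => rfl⟩
    | succ k ih =>
      obtain ⟨L, hL, hLP⟩ := ih
      refine ⟨(T (H (τ k x, x)) (H (τ (k + 1) x, x))).toLinearMap ∘ₗ L,
        ((hε x).2 _ _ (hτs k x)).comp hL, fun v => ?_⟩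
      rw [hPs, hLP]
      rfl
  -- After time `1` the base point no longer moves, and `T` is the identity on the diagonal.
  have hstab : ∀ (k : ℕ) v, 1 ≤ k * ε v.proj → P (k + 1) v = P k v := by
    intro k v hk
    have hk' : 1 ≤ ((k + 1 : ℕ) : ℝ) * ε v.proj := by
      push_cast
      nlinarith [(hε v.proj).1]
    have h : H (τ (k + 1) v.proj, v.proj) = (P k v).proj := by
      rw [hPproj, hτ1 _ _ hk, hτ1 _ _ hk']
    rw [hPs, h, hT]
  have hstab' : ∀ (k m : ℕ) v, 1 ≤ k * ε v.proj → k ≤ m → P m v = P k v := by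
    intro k m v hk hkm
    induction m, hkm using Nat.le_induction with
    | base => rfl
    | succ m hm ih =>
      rw [hstab m v, ih]
      exact hk.trans (mul_le_mul_of_nonneg_right (by exact_mod_cast hm) (hε v.proj).1.le)
  let K : M → ℕ := fun x => ⌈1 / ε x⌉₊
  have hK : ∀ x, 1 ≤ K x * ε x := fun x => by
    rw [← div_le_iff₀ (hε x).1]
    exact Nat.le_ceil _
  have hlin : ∀ x, ∃ L : V x →ₗ[ℝ] V (φ x), Function.Bijective L ∧
      ∀ v, P (K x) ⟨x, v⟩ = ⟨φ x, L v⟩ := by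
    intro x
    have h := hPlin (K x) x
    rwa [hτ1 _ _ (hK x), H1] at h
  choose L hL hLP using hlin
  refine ⟨L, hL, ?_⟩
  have heq : (fun v : TotalSpace F V => TotalSpace.mk' F (φ v.proj) (L v.proj v.snd)) =
      fun v => P (K v.proj) v := funext fun v => (hLP v.proj v.snd).symm
  rw [heq, continuous_iff_continuousAt]
  intro v₀
  -- `K` may jump, but one `k` passes time `1` throughout a neighbourhood of `v₀`, where stability
  -- gives `P (K v.proj) v = P k v`.
  obtain ⟨k, hk⟩ := exists_nat_gt (1 / ε v₀.proj)
  rw [div_lt_iff₀ (hε _).1] at hk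
  have hnear : ∀ᶠ v : TotalSpace F V in 𝓝 v₀, 1 < k * ε v.proj := by
    have hc : Continuous fun v : TotalSpace F V => (k : ℝ) * ε v.proj :=
      continuous_const.mul (ε.continuous.comp (FiberBundle.continuous_proj F V))
    exact hc.continuousAt.eventually (lt_mem_nhds hk)
  refine (hPc k).continuousAt.congr ?_
  filter_upwards [hnear] with v hv
  rcases le_total k (K v.proj) with h | h
  · exact (hstab' _ _ v hv.le h).symm
  · exact hstab' _ _ v (hK _) h

end Homotopy

/-! ### Smoothing a continuous fibrewise isomorphism -/

section Smoothing

variable {E : Type*} [NormedAddCommGroup E] [NormedSpace ℝ E]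
  {M : Type*} [TopologicalSpace M]
  {F : Type*} [NormedAddCommGroup F] [NormedSpace ℝ F]
  {V : M → Type*} [TopologicalSpace (TotalSpace F V)]
  [∀ x, AddCommGroup (V x)] [∀ x, Module ℝ (V x)] [∀ x, TopologicalSpace (V x)]
  [FiberBundle F V] [VectorBundle ℝ F V]

variable (F V) in
/-- A vector bundle over a paracompact base carries a continuous fibrewise norm. -/
theorem Bundle.exists_continuous_fiberwise_norm [T2Space M] [ParacompactSpace M] :
    ∃ p : ∀ x, Seminorm ℝ (V x), (∀ x v, v ≠ 0 → 0 < p x v) ∧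
      Continuous fun v : TotalSpace F V => p v.proj v.snd := by
  obtain ⟨ρ, hρ⟩ := PartitionOfUnity.exists_isSubordinate isClosed_univ
    (fun x : M => (trivializationAt F V x).baseSet)
    (fun x => (trivializationAt F V x).open_baseSet)
    (fun x _ => mem_iUnion.2 ⟨x, FiberBundle.mem_baseSet_trivializationAt' x⟩)
  let f : M → ∀ x, V x → ℝ := fun i x v =>
    ρ i x * ‖(trivializationAt F V i).continuousLinearMapAt ℝ x v‖
  have hfin : ∀ x v, (Function.support fun i => f i x v).Finite := fun x v =>
    (ρ.locallyFinite.point_finite x).subset fun i hi h => hi (by simp only [f]; rw [h, zero_mul])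
  have hf0 : ∀ i x v, 0 ≤ f i x v := fun i x v => mul_nonneg (ρ.nonneg i x) (norm_nonneg _)
  refine ⟨fun x => Seminorm.of (fun v => ∑ᶠ i, f i x v) (fun v w => ?_) (fun c v => ?_),
    fun x v hv => ?_, ?_⟩
  · rw [← finsum_add_distrib (hfin x v) (hfin x w)]
    refine finsum_le_finsum' (hfin x _) ((hfin x v).union (hfin x w) |>.subset
      (Function.support_add _ _)) fun i => ?_
    simp only [f]
    rw [map_add, ← mul_add]
    exact mul_le_mul_of_nonneg_left (norm_add_le _ _) (ρ.nonneg i x)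
  · rw [← smul_eq_mul, smul_finsum]
    refine finsum_congr fun i => ?_
    simp only [f]
    rw [map_smul, norm_smul, smul_eq_mul]
    ring
  · obtain ⟨i, hi⟩ := ρ.exists_pos (mem_univ x)
    have hx : x ∈ (trivializationAt F V i).baseSet := hρ i (subset_tsupport _ hi.ne')
    refine finsum_pos (fun j => hf0 j x v) ⟨i, mul_pos hi (norm_pos_iff.2 fun h => hv ?_)⟩ (hfin x v)
    rw [← (trivializationAt F V i).symmL_continuousLinearMapAt (R := ℝ) hx v, h, map_zero]
  · refine continuous_finsum (f := fun i (v : TotalSpace F V) => f i v.proj v.snd) (fun i => ?_) ?_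
    · rw [continuous_iff_continuousAt]
      intro v₀
      -- The trivialization is continuous only over its base set; off the support of `ρ i` the term
      -- vanishes locally.
      by_cases hv : v₀.proj ∈ tsupport (ρ i)
      · have hx : v₀.proj ∈ (trivializationAt F V i).baseSet := hρ i hv
        have h1 : ContinuousAt (fun v : TotalSpace F V =>
            ρ i v.proj * ‖(trivializationAt F V i v).2‖) v₀ := by
          refine ContinuousAt.mul ((ρ i).continuous.comp
            (FiberBundle.continuous_proj F V)).continuousAt (ContinuousAt.norm ?_)
          exact continuousAt_snd.comp ((trivializationAt F V i).continuousAt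
            ((trivializationAt F V i).mem_source.2 hx))
        refine h1.congr ?_
        filter_upwards [(FiberBundle.continuous_proj F V).continuousAt
          ((trivializationAt F V i).open_baseSet.mem_nhds hx)] with v hv
        simp only [f]
        rw [(trivializationAt F V i).continuousLinearMapAt_apply_of_mem (R := ℝ) hv]
      · refine (continuousAt_const (y := (0 : ℝ))).congr ?_
        filter_upwards [(FiberBundle.continuous_proj F V).continuousAt
          ((isClosed_tsupport (ρ i)).isOpen_compl.mem_nhds hv)] with v hv'
        simp only [f]
        rw [image_eq_zero_of_notMem_tsupport hv', zero_mul]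
    · refine (ρ.locallyFinite.preimage_continuous (FiberBundle.continuous_proj F V)).subset
        fun i v hv h => hv ?_
      simp only [f]
      rw [h, zero_mul]

/-- A continuous fibrewise isomorphism over a smooth map can be replaced by a smooth one. -/
theorem Bundle.exists_contMDiff_of_continuous_lift [ChartedSpace E M] [FiniteDimensional ℝ F]
    [ContMDiffVectorBundle ∞ F V 𝓘(ℝ, E)]
    [FiniteDimensional ℝ E] [IsManifold 𝓘(ℝ, E) ∞ M] [T2Space M] [SigmaCompactSpace M]
    [ParacompactSpace M] {φ : M → M} (hφ : ContMDiff 𝓘(ℝ, E) 𝓘(ℝ, E) ∞ φ)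
    (L : ∀ x, V x →ₗ[ℝ] V (φ x)) (hL : ∀ x, Function.Bijective (L x))
    (hLc : Continuous fun v : TotalSpace F V => TotalSpace.mk' F (φ v.proj) (L v.proj v.snd)) :
    ∃ B : ∀ x, V x →L[ℝ] V (φ x), (∀ x, Function.Bijective (B x)) ∧
      ∀ x₀, ContMDiffAt 𝓘(ℝ, E) 𝓘(ℝ, F →L[ℝ] F) ∞
        (fun x => inCoordinates F V F V x₀ x (φ x₀) (φ x) (B x)) x₀ := by
  have := VectorBundle.isTopologicalAddGroup_fiber F V
  have := VectorBundle.continuousSMul_fiber F V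
  obtain ⟨p, hp, hpc⟩ := exists_continuous_fiberwise_norm F V
  obtain ⟨B, hB, hBs⟩ := exists_contMDiff_hom_forall_mem_convex (F := F) (V := V) (N := M)
    (I := 𝓘(ℝ, E)) contMDiff_id hφ
    (fun x => {A : V x →L[ℝ] V (φ x) | ∀ v, v ≠ 0 → p (φ x) (A v - L x v) < p (φ x) (L x v)})
    (fun x A hA B hB s t hs ht hst v hv =>
      (p (φ x)).convex_ball (L x v) (p (φ x) (L x v)) (hA v hv) (hB v hv) hs ht hst)
    (by
      intro x₀
      set e := trivializationAt F V x₀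
      set e' := trivializationAt F V (φ x₀)
      have hx₀ : x₀ ∈ e.baseSet := FiberBundle.mem_baseSet_trivializationAt' x₀
      have hy₀ : φ x₀ ∈ e'.baseSet := FiberBundle.mem_baseSet_trivializationAt' (φ x₀)
      -- `A` is `L x₀` in coordinates, so the error is zero at `x₀`.
      let A : F →L[ℝ] F := LinearMap.toContinuousLinearMap
        ((e'.continuousLinearMapAt ℝ (φ x₀)).toLinearMap ∘ₗ L x₀ ∘ₗ (e.symmL ℝ x₀).toLinearMap)
      refine ⟨A, ?_⟩
      have hs : ∀ u, ContinuousAt (fun z : M × F => TotalSpace.mk' F z.1 (e.symm z.1 z.2))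
          (x₀, u) := fun u =>
        e.continuousOn_symm.continuousAt ((e.open_baseSet.prod isOpen_univ).mem_nhds ⟨hx₀, trivial⟩)
      have hs' : ∀ w, ContinuousAt (fun z : M × F => TotalSpace.mk' F z.1 (e'.symm z.1 z.2))
          (φ x₀, w) := fun u => e'.continuousOn_symm.continuousAt
            ((e'.open_baseSet.prod isOpen_univ).mem_nhds ⟨hy₀, trivial⟩)
      -- The inequality is homogeneous in `v`, so the compact unit sphere of `F` suffices for a
      -- uniform neighbourhood.
      have key : ∀ᶠ x in 𝓝 x₀, ∀ u ∈ Metric.sphere (0 : F) 1,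
          p (φ x) (e'.symm (φ x) (A u - (e' ⟨φ x, L x (e.symm x u)⟩).2)) <
            p (φ x) (L x (e.symm x u)) := by
        refine (isCompact_sphere (0 : F) 1).eventually_forall_of_forall_eventually fun u hu => ?_
        have hΨ : ContinuousAt (fun z : M × F =>
            TotalSpace.mk' F (φ z.1) (L z.1 (e.symm z.1 z.2))) (x₀, u) :=
          hLc.continuousAt.comp (hs u)
        have hR : ContinuousAt (fun z : M × F => p (φ z.1) (L z.1 (e.symm z.1 z.2))) (x₀, u) :=
          hpc.continuousAt.comp hΨ
        have hl : ContinuousAt (fun z : M × F =>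
            (e' (TotalSpace.mk' F (φ z.1) (L z.1 (e.symm z.1 z.2)))).2) (x₀, u) :=
          continuousAt_snd.comp (ContinuousAt.comp (g := e')
            (e'.continuousAt (e'.mem_source.2 hy₀)) hΨ)
        have hd : ContinuousAt (fun z : M × F => (φ z.1,
            A z.2 - (e' (TotalSpace.mk' F (φ z.1) (L z.1 (e.symm z.1 z.2)))).2)) (x₀, u) :=
          (hφ.continuous.comp continuous_fst).continuousAt.prodMk
            ((A.continuous.comp continuous_snd).continuousAt.sub hl)
        have hLft : ContinuousAt (fun z : M × F => p (φ z.1) (e'.symm (φ z.1)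
            (A z.2 - (e' (TotalSpace.mk' F (φ z.1) (L z.1 (e.symm z.1 z.2)))).2))) (x₀, u) :=
          hpc.continuousAt.comp (ContinuousAt.comp
            (g := fun z : M × F => TotalSpace.mk' F z.1 (e'.symm z.1 z.2)) (f := fun z : M × F =>
              (φ z.1, A z.2 - (e' (TotalSpace.mk' F (φ z.1) (L z.1 (e.symm z.1 z.2)))).2))
            (hs' _) hd)
        refine hLft.eventually_lt hR ?_
        have hAu : A u = (e' ⟨φ x₀, L x₀ (e.symm x₀ u)⟩).2 := by
          have h := e'.continuousLinearMapAt_apply_of_mem (R := ℝ) hy₀ (L x₀ (e.symm x₀ u))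
          rw [← h, ← e.symmL_apply (R := ℝ) hx₀]
          rfl
        have h0 : e'.symm (φ x₀) 0 = 0 := by
          rw [← e'.symmL_apply (R := ℝ) hy₀, map_zero]
        simp only [hAu, sub_self, h0, map_zero]
        refine hp _ _ fun h => ?_
        rw [map_eq_zero_iff _ (hL x₀).1, ← e.symmL_apply (R := ℝ) hx₀] at h
        have hu0 : u = 0 := by
          rw [← e.continuousLinearMapAt_symmL (R := ℝ) hx₀ u, h, map_zero]
        simp [hu0] at hu
      filter_upwards [key, e.open_baseSet.mem_nhds hx₀,
        hφ.continuous.continuousAt (e'.open_baseSet.mem_nhds hy₀)] with x hx hxe hye v hv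
      have hye : φ x ∈ e'.baseSet := hye
      set w := e.continuousLinearMapAt ℝ x v
      have hvw : e.symmL ℝ x w = v := e.symmL_continuousLinearMapAt hxe v
      have hw0 : w ≠ 0 := fun h => hv (by rw [← hvw, h, map_zero])
      have h := hx (‖w‖⁻¹ • w) (by simp [norm_smul, hw0])
      have h1 : e.symm x (‖w‖⁻¹ • w) = ‖w‖⁻¹ • v := by
        rw [← e.symmL_apply (R := ℝ) hxe, map_smul, hvw]
      have h2 : e'.symm (φ x) (A (‖w‖⁻¹ • w) - (e' ⟨φ x, L x (‖w‖⁻¹ • v)⟩).2) =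
          ‖w‖⁻¹ • (homOfModel F V x₀ (φ x₀) A x (φ x) v - L x v) := by
        rw [← e'.continuousLinearMapAt_apply_of_mem (R := ℝ) hye, ← e'.symmL_apply (R := ℝ) hye,
          map_sub, e'.symmL_continuousLinearMapAt hye, map_smul, map_smul, map_smul, smul_sub]
        rfl
      rw [h1, h2, map_smul (L x), map_smul_eq_mul, map_smul_eq_mul] at h
      exact lt_of_mul_lt_mul_left h (norm_nonneg _))
  refine ⟨B, fun x => ?_, hBs⟩
  have hinj : Function.Injective (B x) := by
    rw [injective_iff_map_eq_zero]
    intro v hv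
    by_contra h
    have h1 := hB x v h
    rw [hv, zero_sub, map_neg_eq_map] at h1
    exact lt_irrefl _ h1
  let e₁ := VectorBundle.continuousLinearEquivAt ℝ F V x
  have : FiniteDimensional ℝ (V x) := e₁.symm.toLinearEquiv.finiteDimensional
  have : FiniteDimensional ℝ (V (φ x)) := (LinearEquiv.ofBijective _ (hL x)).finiteDimensional
  exact ⟨hinj, (LinearMap.injective_iff_surjective_of_finrank_eq_finrank
    (f := (B x).toLinearMap) (LinearEquiv.ofBijective _ (hL x)).finrank_eq).1 hinj⟩

end Smoothing

/-! ### From fibrewise isomorphisms to automorphisms -/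

section Lift

variable {E : Type*} [NormedAddCommGroup E] [NormedSpace ℝ E]
  {M : Type*} [TopologicalSpace M] [ChartedSpace E M]
  {F : Type*} [NormedAddCommGroup F] [NormedSpace ℝ F]
  {V : M → Type*} [TopologicalSpace (TotalSpace F V)]
  [∀ x, AddCommGroup (V x)] [∀ x, Module ℝ (V x)] [∀ x, TopologicalSpace (V x)]
  [FiberBundle F V] [VectorBundle ℝ F V]

/-- A smooth fibrewise isomorphism over a diffeomorphism is a bundle automorphism. -/
theorem SmoothBundleAut.exists_hV_eq_of_bijective [FiniteDimensional ℝ F]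
    [ContMDiffVectorBundle ∞ F V 𝓘(ℝ, E)] (φ : Diffeomorph 𝓘(ℝ, E) 𝓘(ℝ, E) M M ∞)
    (B : ∀ x, V x →L[ℝ] V (φ x)) (hB : ∀ x, Function.Bijective (B x))
    (hBs : ∀ x₀, ContMDiffAt 𝓘(ℝ, E) 𝓘(ℝ, F →L[ℝ] F) ∞
      (fun x => inCoordinates F V F V x₀ x (φ x₀) (φ x) (B x)) x₀) :
    ∃ Φ : SmoothBundleAut (E := E) F V, Φ.hV = φ := by
  have := FiniteDimensional.complete ℝ F
  have hC : ∀ x, ∃ C : V x ≃L[ℝ] V (φ x), (C : V x →L[ℝ] V (φ x)) = B x := by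
    intro x
    let e₁ := VectorBundle.continuousLinearEquivAt ℝ F V x
    let e₂ := VectorBundle.continuousLinearEquivAt ℝ F V (φ x)
    let A : F ≃L[ℝ] F := (LinearEquiv.ofBijective
      (((e₂ : V (φ x) →L[ℝ] F).comp ((B x).comp (e₁.symm : F →L[ℝ] V x))).toLinearMap)
      (e₂.bijective.comp ((hB x).comp e₁.symm.bijective))).toContinuousLinearEquiv
    refine ⟨(e₁.trans A).trans e₂.symm, ?_⟩
    ext v
    change e₂.symm (e₂ (B x (e₁.symm (e₁ v)))) = B x v
    rw [e₁.symm_apply_apply, e₂.symm_apply_apply]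
  choose C hC using hC
  have hCs : ∀ x₀, ContMDiffAt 𝓘(ℝ, E) 𝓘(ℝ, F →L[ℝ] F) ∞ (fun x =>
      inCoordinates F V F V (φ x₀) (φ x) x₀ x ((C x).symm : V (φ x) →L[ℝ] V x)) x₀ := by
    intro x₀
    have hx₀ := FiberBundle.mem_baseSet_trivializationAt' (F := F) (E := V) x₀
    have hy₀ := FiberBundle.mem_baseSet_trivializationAt' (F := F) (E := V) (φ x₀)
    have hcoord : ∀ x (hx : x ∈ (trivializationAt F V x₀).baseSet)
        (hy : φ x ∈ (trivializationAt F V (φ x₀)).baseSet), ∃ A : F ≃L[ℝ] F,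
        inCoordinates F V F V x₀ x (φ x₀) (φ x) (B x) = A ∧
        inCoordinates F V F V (φ x₀) (φ x) x₀ x ((C x).symm : V (φ x) →L[ℝ] V x) = A.symm := by
      intro x hx hy
      refine ⟨(((trivializationAt F V x₀).continuousLinearEquivAt ℝ x hx).symm.trans (C x)).trans
        ((trivializationAt F V (φ x₀)).continuousLinearEquivAt ℝ (φ x) hy), ?_, ?_⟩
      · rw [inCoordinates_eq hx hy, ← hC]
        rfl
      · rw [inCoordinates_eq hy hx]
        rfl
    obtain ⟨A₀, hA₀, -⟩ := hcoord x₀ hx₀ hy₀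
    -- In coordinates the inverse family is operator inversion applied to the family `B`.
    have hinv : ContMDiffAt 𝓘(ℝ, F →L[ℝ] F) 𝓘(ℝ, F →L[ℝ] F) ∞ ContinuousLinearMap.inverse
        (inCoordinates F V F V x₀ x₀ (φ x₀) (φ x₀) (B x₀)) := by
      rw [hA₀]
      exact (contDiffAt_map_inverse A₀).contMDiffAt
    refine (ContMDiffAt.comp x₀ hinv (hBs x₀)).congr_of_eventuallyEq ?_
    filter_upwards [(trivializationAt F V x₀).open_baseSet.mem_nhds hx₀,
      φ.continuous.continuousAt ((trivializationAt F V (φ x₀)).open_baseSet.mem_nhds hy₀)]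
      with x hx hy
    obtain ⟨A, hA, hA'⟩ := hcoord x hx hy
    rw [Function.comp_apply, hA, hA', ContinuousLinearMap.inverse_equiv]
  have hcast : ∀ (w : TotalSpace F V) (y : M) (h : w.proj = y),
      TotalSpace.mk' F y (h ▸ w.snd : V y) = w := by
    rintro w y rfl
    rfl
  let f : TotalSpace F V → TotalSpace F V := fun v => ⟨φ v.proj, B v.proj v.snd⟩
  -- `φ (φ.symm y) = y` is not definitional, so the vector is cast; in the total space the cast is
  -- the identity, hence smooth.
  let c : ∀ w : TotalSpace F V, V (φ (φ.symm w.proj)) := fun w =>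
    (φ.apply_symm_apply w.proj).symm ▸ w.snd
  have hc : ∀ w, TotalSpace.mk' F (φ (φ.symm w.proj)) (c w) = w := fun w => hcast w _ _
  let g : TotalSpace F V → TotalSpace F V := fun w =>
    ⟨φ.symm w.proj, (C (φ.symm w.proj)).symm (c w)⟩
  have hfg : ∀ w, f (g w) = w := by
    intro w
    refine Eq.trans ?_ (hc w)
    simp only [f, g, ← hC, ContinuousLinearEquiv.coe_coe, ContinuousLinearEquiv.apply_symm_apply]
  have hf : Function.Injective f := by
    rintro ⟨x, v⟩ ⟨x', v'⟩ h
    obtain rfl : x = x' := φ.injective (congrArg TotalSpace.proj h)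
    have h' : B x v = B x v' := (TotalSpace.mk_inj (F := F)).1 h
    rw [(hB x).1 h']
  have hproj : ContMDiff (𝓘(ℝ, E).prod 𝓘(ℝ, F)) 𝓘(ℝ, E) ∞ (π F V) :=
    contMDiff_proj (n := ∞) V
  have hfs : ContMDiff (𝓘(ℝ, E).prod 𝓘(ℝ, F)) (𝓘(ℝ, E).prod 𝓘(ℝ, F)) ∞ f := by
    intro v₀
    refine ContMDiffAt.clm_apply_of_inCoordinates (IB₁ := 𝓘(ℝ, E)) (IB₂ := 𝓘(ℝ, E))
      (F₁ := F) (E₁ := V) (F₂ := F) (E₂ := V)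
      (b₁ := fun v : TotalSpace F V => v.proj) (b₂ := fun v => φ v.proj)
      (ϕ := fun v => B v.proj) (v := fun v => v.snd) ?_ contMDiffAt_id
      (φ.contMDiff.comp hproj).contMDiffAt
    exact (hBs v₀.proj).comp v₀ hproj.contMDiffAt
  have hgs : ContMDiff (𝓘(ℝ, E).prod 𝓘(ℝ, F)) (𝓘(ℝ, E).prod 𝓘(ℝ, F)) ∞ g := by
    intro w₀
    have hb : ContMDiff (𝓘(ℝ, E).prod 𝓘(ℝ, F)) 𝓘(ℝ, E) ∞
        fun w : TotalSpace F V => φ.symm w.proj := φ.symm.contMDiff.comp hproj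
    refine ContMDiffAt.clm_apply_of_inCoordinates (IB₁ := 𝓘(ℝ, E)) (IB₂ := 𝓘(ℝ, E))
      (F₁ := F) (E₁ := V) (F₂ := F) (E₂ := V)
      (b₁ := fun w : TotalSpace F V => φ (φ.symm w.proj)) (b₂ := fun w => φ.symm w.proj)
      (ϕ := fun w => ((C (φ.symm w.proj)).symm : V _ →L[ℝ] V _)) (v := c) ?_ ?_ hb.contMDiffAt
    · exact (hCs (φ.symm w₀.proj)).comp w₀ hb.contMDiffAt
    · exact contMDiffAt_id.congr_of_eventuallyEq (Eventually.of_forall hc)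
  let D : Diffeomorph (𝓘(ℝ, E).prod 𝓘(ℝ, F)) (𝓘(ℝ, E).prod 𝓘(ℝ, F))
      (TotalSpace F V) (TotalSpace F V) ∞ :=
    { toFun := f
      invFun := g
      left_inv := fun v => hf (hfg (f v))
      right_inv := hfg
      contMDiff_toFun := hfs
      contMDiff_invFun := hgs }
  exact ⟨⟨D, fun x => ⟨φ x, LinearEquiv.ofBijective (B x).toLinearMap (hB x), fun v => rfl⟩⟩,
    Diffeomorph.ext fun x => rfl⟩

end Lift

end

theorem mainTheorem1
    {E : Type*} [NormedAddCommGroup E] [NormedSpace ℝ E] [FiniteDimensional ℝ E]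
    {M : Type*} [TopologicalSpace M] [ChartedSpace E M] [IsManifold 𝓘(ℝ, E) ∞ M]
    [T2Space M] [SecondCountableTopology M] [ConnectedSpace M]
    {F : Type*} [NormedAddCommGroup F] [NormedSpace ℝ F] [FiniteDimensional ℝ F]
    {V : M → Type*} [TopologicalSpace (TotalSpace F V)]
    [∀ x, AddCommGroup (V x)] [∀ x, Module ℝ (V x)] [∀ x, TopologicalSpace (V x)]
    [FiberBundle F V] [VectorBundle ℝ F V] [ContMDiffVectorBundle ∞ F V 𝓘(ℝ, E)]
    (φ : Diffeomorph 𝓘(ℝ, E) 𝓘(ℝ, E) M M ∞)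
    (hφ : ContinuousMap.Homotopic (⟨φ, φ.continuous⟩ : C(M, M)) (ContinuousMap.id M)) :
    ∃ Φ : SmoothBundleAut (E := E) F V, Φ.hV = φ := by
  have := FiniteDimensional.complete ℝ F
  -- With second countability and Hausdorffness this yields σ-compactness, paracompactness and
  -- normality.
  have : LocallyCompactSpace M := Manifold.locallyCompact_of_finiteDimensional 𝓘(ℝ, E)
  obtain ⟨T, hT, hT', hTc⟩ := exists_continuous_two_point_transport (E := E) (F := F) (V := V)
  -- Reversed, so that the paths start at `x` and end at `φ x`.
  obtain ⟨H⟩ := hφ.symm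
  obtain ⟨L, hL, hLc⟩ := exists_continuous_lift_of_homotopy T hT hT' hTc φ H.toContinuousMap
    (fun x => H.apply_zero x) (fun x => H.apply_one x)
  obtain ⟨B, hB, hBs⟩ := exists_contMDiff_of_continuous_lift φ.contMDiff L hL hLc
  exact SmoothBundleAut.exists_hV_eq_of_bijective φ B hB hBs
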